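/- A (finite) hypergraph $G=(V,E)$ consists of a finite vertex set $V$ and a set $E$ of subsets of $V$, the edges. For an integer $t\ge 0$, $G$ is called $t$-intersecting if any two distinct edges $e,e'\in E$ satisfy $|e\cap e'|\ge t$. For an integer $c\ge 2$, a $c$-strong coloring of $G$ is an assignment of colors to the vertices of $G$ such that each edge $e\in E$ contains vertices of at least $\min\{c,|e|\}$ distinct colors. Let $\chi(t,c)\in\mathbb{N}\cup\{\infty\}$ denote the minimum number of colors which suffices to $c$-strong color every $t$-intersecting hypergraph (with $\chi(t,c)=\infty$ if no finite number of colors suffices). Then for all integers $c\ge 2$ and $t\ge 2c$, $$\chi(t,c) < 2c^2.$$ -/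

import Mathlib

/-- A hypergraph is `t`-intersecting if any two (distinct) edges share at least `t` vertices. -/
def Hypergraph.IsTIntersecting {α : Type*} (G : Hypergraph α) (t : ℕ) : Prop :=
  ∀ e ∈ G.edgeSet, ∀ e' ∈ G.edgeSet, e ≠ e' → (t : ℕ∞) ≤ (e ∩ e').encard

/-- The assignment `f` of colors to vertices is a `c`-strong coloring of `G` if every edge `e`
covers vertices with at least `min {c, |e|}` distinct colors. -/
def Hypergraph.IsStrongColoring {α β : Type*} (G : Hypergraph α) (c : ℕ) (f : α → β) : Prop :=
  ∀ e ∈ G.edgeSet, min (c : ℕ∞) e.encard ≤ (f '' e).encard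

/-- `G` has a `c`-strong coloring with (at most) `l` colors, the colors being `0, …, l - 1`.
Only the colors of elements of the vertex set matter. -/
def Hypergraph.StrongColorable {α : Type*} (G : Hypergraph α) (c l : ℕ) : Prop :=
  ∃ f : α → ℕ, (∀ v ∈ G.vertexSet, f v < l) ∧ G.IsStrongColoring c f

/-- The `c`-strong chromatic number `χ(t, c)` of `t`-intersecting hypergraphs: the minimum number
of colors which suffices to `c`-strong color any `t`-intersecting (finite) hypergraph, and `⊤` if
no finite number of colors suffices. -/
noncomputable def strongChromaticNumber (t c : ℕ) : ℕ∞ :=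
  ⨅ (l : ℕ) (_ : ∀ (α : Type) (G : Hypergraph α), G.vertexSet.Finite →
    G.IsTIntersecting t → G.StrongColorable c l), (l : ℕ∞)

/-! Color the vertices uniformly with `l = 2c² - 1` colors. An edge fails exactly when it lies in
the preimage of some set of `k = c - 1` colors. That preimage is a `p`-random vertex set with `p = k
/ l`, and the vertex sets containing an edge form a `t`-intersecting family, of measure at most `(p
/ (1 - p)) ^ t = (k / (l - k)) ^ t` (`biasedMeasure_le`). A union bound over the color sets
(`exists_coloring`) then leaves a good coloring. The measure bound comes from its two-family
version, `biasedMeasure_mul_le`, by induction on the ground set. -/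

open Finset in
/-- The probability that the random subset of `V`, each element being taken independently with
probability `p`, satisfies `P`. -/
noncomputable def biasedMeasure {ι : Type*} [DecidableEq ι] (p : ℝ) (V : Finset ι)
    (P : Finset ι → Prop) : ℝ :=
  open Classical in ∑ s ∈ V.powerset, if P s then p ^ #s * (1 - p) ^ #(V \ s) else 0

section

variable {ι : Type*} [DecidableEq ι] {p : ℝ}

open Finset

lemma biasedMeasure_nonneg (hp0 : 0 ≤ p) (hp1 : p ≤ 1) (V : Finset ι) (P : Finset ι → Prop) :
    0 ≤ biasedMeasure p V P := by
  have : 0 ≤ 1 - p := by linarith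
  refine sum_nonneg fun s _ => ?_
  split_ifs <;> positivity

lemma biasedMeasure_insert {a : ι} {V : Finset ι} (ha : a ∉ V) (P : Finset ι → Prop) :
    biasedMeasure p (insert a V) P =
      (1 - p) * biasedMeasure p V P + p * biasedMeasure p V (fun s => P (insert a s)) := by
  unfold biasedMeasure
  rw [sum_powerset_insert ha, mul_sum, mul_sum]
  congr 1
  · refine sum_congr rfl fun s hs => ?_
    have has : a ∉ s := fun h => ha (mem_powerset.1 hs h)
    rw [insert_sdiff_of_notMem _ has, card_insert_of_notMem (by simp [ha])]
    split_ifs <;> ring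
  · refine sum_congr rfl fun s hs => ?_
    have has : a ∉ s := fun h => ha (mem_powerset.1 hs h)
    rw [insert_sdiff_insert, sdiff_insert_of_notMem ha, card_insert_of_notMem has]
    split_ifs <;> ring

lemma biasedMeasure_le_one (hp0 : 0 ≤ p) (hp1 : p ≤ 1) (V : Finset ι) (P : Finset ι → Prop) :
    biasedMeasure p V P ≤ 1 := by
  induction V using Finset.induction_on generalizing P with
  | empty => unfold biasedMeasure; simp; split_ifs <;> norm_num
  | insert a V ha ih =>
    rw [biasedMeasure_insert ha]
    nlinarith [ih P, ih (fun s => P (insert a s))]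

/-- The inductive step for the product of the measures of two cross-intersecting families. -/
lemma mixed_mul_mixed_le {q r a₀ a₁ b₀ b₁ : ℝ} (hp0 : 0 < p) (hp1 : p < 1)
    (hq : q * (1 - p) = p) (hr : 0 < r) (ha₁ : 0 ≤ a₁) (hb₀ : 0 ≤ b₀)
    (h00 : a₀ * b₀ ≤ r) (h01 : a₀ * b₁ ≤ r) (h10 : a₁ * b₀ ≤ r) (h11 : q ^ 2 * (a₁ * b₁) ≤ r) :
    ((1 - p) * a₀ + p * a₁) * ((1 - p) * b₀ + p * b₁) ≤ r := by
  have hpp : 0 < 1 - p := by linarith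
  have key : (1 - p) ^ 2 * (a₀ * b₀) + p ^ 2 * (a₁ * b₁) ≤ ((1 - p) ^ 2 + p ^ 2) * r := by
    rcases le_total (a₁ * b₁) r with h | h
    · nlinarith [sq_nonneg (1 - p), sq_nonneg p]
    -- With `x = a₀ * b₀` and `y = a₁ * b₁`, multiply the goal by `y` and use `x * y ≤ r ^ 2`. What
    -- remains is `(y - r) * ((1 - p) ^ 2 * r - p ^ 2 * y) ≥ 0`.
    · have hx : 0 < a₁ * b₁ := hr.trans_le h
      have hprod : (a₀ * b₀) * (a₁ * b₁) ≤ r * r := by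
        calc (a₀ * b₀) * (a₁ * b₁) = (a₀ * b₁) * (a₁ * b₀) := by ring
          _ ≤ r * r := mul_le_mul h01 h10 (by positivity) hr.le
      have hp2 : p ^ 2 * (a₁ * b₁) ≤ (1 - p) ^ 2 * r := by
        calc p ^ 2 * (a₁ * b₁) = (1 - p) ^ 2 * (q ^ 2 * (a₁ * b₁)) := by
              nth_rewrite 1 [← hq]; ring
          _ ≤ _ := by gcongr
      refine le_of_mul_le_mul_right ?_ hx
      have h1 : (1 - p) ^ 2 * ((a₀ * b₀) * (a₁ * b₁)) ≤ (1 - p) ^ 2 * (r * r) := by gcongr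
      nlinarith [mul_nonneg (sub_nonneg.2 h) (sub_nonneg.2 hp2)]
  have e1 : p * (1 - p) * (a₀ * b₁) ≤ p * (1 - p) * r := by gcongr
  have e2 : p * (1 - p) * (a₁ * b₀) ≤ p * (1 - p) * r := by gcongr
  nlinarith

/-- Cross-`t`-intersecting families have product measure at most `(p / (1 - p)) ^ (2 * t)`. -/
lemma biasedMeasure_mul_le {q : ℝ} (hp0 : 0 < p) (hp1 : p < 1) (hq : q * (1 - p) = p)
    (hq0 : 0 < q) (hq1 : q ≤ 1) (V : Finset ι) (t : ℕ) (P Q : Finset ι → Prop)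
    (h : ∀ s ⊆ V, ∀ s' ⊆ V, P s → Q s' → t ≤ #(s ∩ s')) :
    biasedMeasure p V P * biasedMeasure p V Q ≤ (q ^ 2) ^ t := by
  induction V using Finset.induction_on generalizing P Q t with
  | empty =>
    rcases Nat.eq_zero_or_pos t with rfl | ht
    · rw [pow_zero]
      exact mul_le_one₀ (biasedMeasure_le_one hp0.le hp1.le _ _)
        (biasedMeasure_nonneg hp0.le hp1.le _ _) (biasedMeasure_le_one hp0.le hp1.le _ _)
    · have hPQ : ¬ (P ∅ ∧ Q ∅) := fun hPQ => by
        have := h ∅ subset_rfl ∅ subset_rfl hPQ.1 hPQ.2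
        simp at this
        omega
      have : biasedMeasure p ∅ P * biasedMeasure p ∅ Q = 0 := by
        unfold biasedMeasure
        simp
        tauto
      rw [this]
      positivity
  | insert a V ha ih =>
    have hmem : ∀ s ⊆ V, a ∉ s := fun s hs h => ha (hs h)
    have hsub : ∀ s ⊆ V, s ⊆ insert a V := fun s hs => hs.trans (subset_insert _ _)
    have hins : ∀ s ⊆ V, insert a s ⊆ insert a V := fun s hs => insert_subset_insert _ hs
    rw [biasedMeasure_insert ha, biasedMeasure_insert ha]
    refine mixed_mul_mixed_le hp0 hp1 hq (by positivity)
      (biasedMeasure_nonneg hp0.le hp1.le _ _) (biasedMeasure_nonneg hp0.le hp1.le _ _)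
      (ih _ _ _ fun s hs s' hs' hP hQ => h s (hsub s hs) s' (hsub s' hs') hP hQ)
      (ih _ _ _ fun s hs s' hs' hP hQ => ?_) (ih _ _ _ fun s hs s' hs' hP hQ => ?_) ?_
    · have := h s (hsub s hs) _ (hins s' hs') hP hQ
      rwa [inter_insert_of_notMem (hmem s hs)] at this
    · have := h _ (hins s hs) s' (hsub s' hs') hP hQ
      rwa [insert_inter_of_notMem (hmem s' hs')] at this
    · cases t with
      | zero =>
        rw [pow_zero]
        refine mul_le_one₀ (pow_le_one₀ hq0.le hq1) (mul_nonneg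
          (biasedMeasure_nonneg hp0.le hp1.le _ _) (biasedMeasure_nonneg hp0.le hp1.le _ _)) ?_
        exact mul_le_one₀ (biasedMeasure_le_one hp0.le hp1.le _ _)
          (biasedMeasure_nonneg hp0.le hp1.le _ _) (biasedMeasure_le_one hp0.le hp1.le _ _)
      -- When both sets contain `a`, it accounts for one common element: the traces on `V` need only
      -- share `t`, and the lost factor `q ^ 2` is the one `h11` supplies.
      | succ t =>
        rw [pow_succ' _ t]
        refine mul_le_mul_of_nonneg_left (ih _ _ _ fun s hs s' hs' hP hQ => ?_) (by positivity)
        have := h _ (hins s hs) _ (hins s' hs') hP hQ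
        rw [← insert_inter_distrib, card_insert_of_notMem] at this
        · omega
        · exact fun h => hmem s hs (mem_inter.1 h).1

/-- A `t`-intersecting family has measure at most `(p / (1 - p)) ^ t`. -/
lemma biasedMeasure_le {q : ℝ} (hp0 : 0 < p) (hp1 : p < 1) (hq : q * (1 - p) = p)
    (hq0 : 0 < q) (hq1 : q ≤ 1) (V : Finset ι) (t : ℕ) (P : Finset ι → Prop)
    (h : ∀ s ⊆ V, ∀ s' ⊆ V, P s → P s' → t ≤ #(s ∩ s')) :
    biasedMeasure p V P ≤ q ^ t := by
  have := biasedMeasure_mul_le hp0 hp1 hq hq0 hq1 V t P P h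
  rw [pow_right_comm, ← sq] at this
  exact le_of_sq_le_sq this (by positivity)

open Classical in
/-- For a uniformly random coloring, the set of vertices whose color lies in `S` is a random set
in which each vertex is taken with probability `#S / l`. -/
lemma card_filter_preimage [Fintype ι] {l : ℕ} (hl : 0 < l) (S : Finset (Fin l))
    (P : Finset ι → Prop) :
    (#{g : ι → Fin l | P {i | g i ∈ S}} : ℝ) =
      l ^ Fintype.card ι * biasedMeasure (#S / l : ℝ) univ P := by
  have hl' : (l : ℝ) ≠ 0 := by positivity
  have hfib : ∀ s : Finset ι, #{g : ι → Fin l | ({i | g i ∈ S} : Finset ι) = s} =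
      #S ^ #s * (l - #S) ^ #(univ \ s) := by
    intro s
    have : ({g : ι → Fin l | ({i | g i ∈ S} : Finset ι) = s} : Finset _) =
        Fintype.piFinset fun i => if i ∈ s then S else Sᶜ := by
      ext g
      simp only [mem_filter, mem_univ, true_and, Fintype.mem_piFinset, Finset.ext_iff]
      refine forall_congr' fun i => ?_
      by_cases h : i ∈ s <;> simp [h]
    rw [this, Fintype.card_piFinset]
    simp only [apply_ite Finset.card, card_compl, Fintype.card_fin]
    rw [prod_ite]
    simp [filter_not]
  have hSl : #S ≤ l := by simpa using card_le_univ S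
  rw [card_eq_sum_card_fiberwise (f := fun g : ι → Fin l => ({i | g i ∈ S} : Finset ι))
    (t := univ.powerset) (by intro; simp), biasedMeasure, mul_sum, Nat.cast_sum]
  refine sum_congr rfl fun s _ => ?_
  rw [filter_filter]
  split_ifs with hs
  · have hcard : Fintype.card ι = #s + #(univ \ s) := by
      rw [card_sdiff_of_subset (subset_univ s), card_univ]
      have := card_le_univ s
      omega
    have : ({g : ι → Fin l | P {i | g i ∈ S} ∧ ({i | g i ∈ S} : Finset ι) = s} : Finset (ι → Fin l)) =
        ({g : ι → Fin l | ({i | g i ∈ S} : Finset ι) = s} : Finset (ι → Fin l)) := by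
      refine filter_congr fun g _ => ⟨fun h => h.2, fun h => ⟨h ▸ hs, h⟩⟩
    rw [this, hfib, hcard, pow_add]
    push_cast [Nat.cast_sub hSl]
    rw [one_sub_div hl', div_pow, div_pow]
    field_simp
  · rw [mul_zero, Nat.cast_eq_zero, card_eq_zero, filter_eq_empty_iff]
    rintro g - ⟨h1, h2⟩
    exact hs (h2 ▸ h1)

/-- A `t`-intersecting family admits a coloring with `l` colors in which every member has more
than `k` colors, as soon as a random coloring works in expectation. -/
lemma exists_coloring [Fintype ι] {k l t : ℕ} (hk : 0 < k) (hkl : 2 * k ≤ l)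
    (hlt : (l.choose k : ℝ) * ((k : ℝ) / (l - k)) ^ t < 1) (E : Set (Finset ι))
    (hE : ∀ e ∈ E, ∀ e' ∈ E, t ≤ #(e ∩ e')) :
    ∃ g : ι → Fin l, ∀ e ∈ E, k < #(e.image g) := by
  classical
  have hl : 0 < l := by omega
  have hk' : (0 : ℝ) < k := by positivity
  have hl' : (0 : ℝ) < l := by positivity
  have hkl' : 2 * (k : ℝ) ≤ l := by exact_mod_cast hkl
  have hd : (0 : ℝ) < l - k := by linarith
  -- The up-closure of `E` inherits the intersection property.
  let P : Finset ι → Prop := fun s => ∃ e ∈ E, e ⊆ s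
  have hμ : biasedMeasure ((k : ℝ) / l) univ P ≤ ((k : ℝ) / (l - k)) ^ t := by
    refine biasedMeasure_le (by positivity) ?_ ?_ (by positivity) ?_ _ _ _ ?_
    · rw [div_lt_one hl']; linarith
    · rw [one_sub_div hl'.ne']; field_simp
    · rw [div_le_one hd]; linarith
    · rintro s - s' - ⟨e, he, hes⟩ ⟨e', he', hes'⟩
      exact (hE e he e' he').trans (card_le_card (inter_subset_inter hes hes'))
  let bad : Finset (ι → Fin l) :=
    (powersetCard k univ).biUnion fun S : Finset (Fin l) => {g | P {i | g i ∈ S}}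
  have hbad : #bad < Fintype.card (ι → Fin l) := by
    have h1 : (#bad : ℝ) ≤
        ∑ S ∈ powersetCard k (univ : Finset (Fin l)), (#{g : ι → Fin l | P {i | g i ∈ S}} : ℝ) := by
      exact_mod_cast card_biUnion_le
    have h2 : ∑ S ∈ powersetCard k (univ : Finset (Fin l)),
        (#{g : ι → Fin l | P {i | g i ∈ S}} : ℝ) =
        l.choose k * (l ^ Fintype.card ι * biasedMeasure ((k : ℝ) / l) univ P) := by
      rw [sum_congr rfl (g := fun _ => l ^ Fintype.card ι * biasedMeasure ((k : ℝ) / l) univ P)]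
      · simp
      · intro S hS
        convert card_filter_preimage hl S P
        exact (mem_powersetCard.1 hS).2.symm
    have h3 : (#bad : ℝ) < l ^ Fintype.card ι := by
      calc (#bad : ℝ) ≤ l.choose k * (l ^ Fintype.card ι * biasedMeasure ((k : ℝ) / l) univ P) :=
            h1.trans h2.le
        _ ≤ l.choose k * (l ^ Fintype.card ι * ((k : ℝ) / (l - k)) ^ t) := by gcongr
        _ = l.choose k * ((k : ℝ) / (l - k)) ^ t * l ^ Fintype.card ι := by ring
        _ < 1 * l ^ Fintype.card ι := by gcongr
        _ = _ := one_mul _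
    rw [Fintype.card_fun, Fintype.card_fin]
    exact_mod_cast h3
  obtain ⟨g, -, hg⟩ := exists_mem_notMem_of_card_lt_card (s := bad) (t := univ) hbad
  refine ⟨g, fun e he => ?_⟩
  by_contra! hle
  -- Padding the color set to exactly `k` colors lets the union bound range over `k`-sets only.
  obtain ⟨S, hS, hcard⟩ := exists_superset_card_eq hle (by simpa using (by omega : k ≤ l))
  refine hg (mem_biUnion.2 ⟨S, mem_powersetCard.2 ⟨subset_univ _, hcard⟩, ?_⟩)
  exact mem_filter.2 ⟨mem_univ _, e, he, fun i hi =>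
    mem_filter.2 ⟨mem_univ _, hS (mem_image_of_mem g hi)⟩⟩

end

/-- The fraction is at most `1 / (2c)`, so its `2c`-th power is at most `(4c²) ^ (-c)`, which beats
the crude bound `(2c²) ^ (c - 1)` on the binomial. -/
lemma choose_mul_pow_lt_one {c : ℕ} (hc : 2 ≤ c) :
    ((2 * c ^ 2 - 1).choose (c - 1) : ℝ) *
      (((c - 1 : ℕ) : ℝ) / ((2 * c ^ 2 - 1 : ℕ) - (c - 1 : ℕ))) ^ (2 * c) < 1 := by
  have hc' : (2 : ℝ) ≤ c := by exact_mod_cast hc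
  have hsq : 1 ≤ 2 * c ^ 2 := by nlinarith
  have h1 : ((2 * c ^ 2 - 1).choose (c - 1) : ℝ) ≤ (2 * (c : ℝ) ^ 2) ^ (c - 1) := by
    have : (2 * c ^ 2 - 1).choose (c - 1) ≤ (2 * c ^ 2) ^ (c - 1) :=
      (Nat.choose_le_pow _ _).trans (Nat.pow_le_pow_left (Nat.sub_le _ _) _)
    exact_mod_cast this
  have h2 : ((c - 1 : ℕ) : ℝ) / ((2 * c ^ 2 - 1 : ℕ) - (c - 1 : ℕ)) ≤ 1 / (2 * c) := by
    rw [Nat.cast_sub hsq, Nat.cast_sub (by omega : 1 ≤ c)]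
    push_cast
    rw [div_le_div_iff₀ (by nlinarith) (by linarith)]
    nlinarith
  have h0 : 0 ≤ ((c - 1 : ℕ) : ℝ) / ((2 * c ^ 2 - 1 : ℕ) - (c - 1 : ℕ)) := by
    refine div_nonneg (Nat.cast_nonneg _) (sub_nonneg.2 (Nat.cast_le.2 ?_))
    exact Nat.sub_le_sub_right (by nlinarith) _
  calc _ ≤ (2 * (c : ℝ) ^ 2) ^ (c - 1) * (1 / (2 * c)) ^ (2 * c) := by gcongr
    _ < (4 * (c : ℝ) ^ 2) ^ c * (1 / (2 * c)) ^ (2 * c) := by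
      gcongr ?_ * _
      calc (2 * (c : ℝ) ^ 2) ^ (c - 1) ≤ (2 * (c : ℝ) ^ 2) ^ c :=
            pow_le_pow_right₀ (by nlinarith) (Nat.sub_le _ _)
        _ < (4 * (c : ℝ) ^ 2) ^ c := by
            refine pow_lt_pow_left₀ (by nlinarith) (by positivity) (by omega)
    _ = 1 := by
      rw [pow_mul, ← mul_pow]
      rw [show 4 * (c : ℝ) ^ 2 * (1 / (2 * c)) ^ 2 = 1 by field_simp; norm_num, one_pow]

/-- A set with at most `l` elements can be colored injectively with `l` colors. -/
lemma Set.exists_injOn_lt {α : Type*} {e : Set α} {l : ℕ} (hl : 0 < l) (he : e.encard ≤ l) :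
    ∃ f : α → ℕ, (∀ v, f v < l) ∧ Set.InjOn f e := by
  have hfin : e.Finite := Set.finite_of_encard_le_coe he
  have hcard : e.encard ≤ (Set.Iio l).encard := by
    simpa [Set.encard_coe_eq_coe_finsetCard, ← Finset.coe_Iio] using he
  have : Nonempty ℕ := ⟨0⟩
  obtain ⟨f, hf, hinj⟩ := hfin.exists_injOn_of_encard_le hcard
  classical
  refine ⟨fun v => if v ∈ e then f v else 0, fun v => ?_, fun x hx y hy hxy => ?_⟩
  · by_cases hv : v ∈ e
    · simpa [hv] using hf hv
    · simpa [hv] using hl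
  · exact hinj hx hy (by simpa [hx, hy] using hxy)

lemma Hypergraph.IsTIntersecting.strongColorable {α : Type*} {G : Hypergraph α} {c : ℕ}
    (hc : 2 ≤ c) (hV : G.vertexSet.Finite) (hG : G.IsTIntersecting (2 * c)) :
    G.StrongColorable c (2 * c ^ 2 - 1) := by
  classical
  have hl : 2 * c ≤ 2 * c ^ 2 - 1 := Nat.le_sub_of_add_le (by nlinarith)
  have hl0 : 0 < 2 * c ^ 2 - 1 := by omega
  -- An edge with fewer than `2c` vertices must be the only edge. Otherwise the intersection bound
  -- also holds for `e = e'`, as `exists_coloring` requires.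
  by_cases hsmall : ∃ e ∈ G.edgeSet, e.encard < (2 * c : ℕ)
  · obtain ⟨e, he, hlt⟩ := hsmall
    obtain ⟨f, hf, hinj⟩ := Set.exists_injOn_lt hl0 (hlt.le.trans (Nat.cast_le.2 hl))
    refine ⟨f, fun v _ => hf v, fun e' he' => ?_⟩
    have hee : e = e' := by
      by_contra hne
      exact absurd ((hG e he e' he' hne).trans (Set.encard_le_encard Set.inter_subset_left))
        (not_le.2 hlt)
    rw [← hee, hinj.encard_image]
    exact min_le_right _ _
  · push Not at hsmall
    have : Fintype G.vertexSet := hV.fintype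
    let E : Set (Finset G.vertexSet) := {s | (Subtype.val '' (s : Set G.vertexSet)) ∈ G.edgeSet}
    have hE : ∀ e ∈ E, ∀ e' ∈ E, 2 * c ≤ (e ∩ e').card := by
      intro e he e' he'
      have key : ((2 * c : ℕ) : ℕ∞) ≤
          ((Subtype.val '' (e : Set G.vertexSet)) ∩
            (Subtype.val '' (e' : Set G.vertexSet))).encard := by
        by_cases h : (Subtype.val '' (e : Set G.vertexSet)) =
            Subtype.val '' (e' : Set G.vertexSet)
        · rw [← h, Set.inter_self]
          exact hsmall _ he
        · exact hG _ he _ he' h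
      rw [← Set.image_inter Subtype.val_injective, Subtype.val_injective.encard_image,
        ← Finset.coe_inter, Set.encard_coe_eq_coe_finsetCard] at key
      exact_mod_cast key
    obtain ⟨g, hg⟩ := exists_coloring (k := c - 1) (by omega) (by omega)
      (choose_mul_pow_lt_one hc) E hE
    refine ⟨fun v => if h : v ∈ G.vertexSet then g ⟨v, h⟩ else 0, fun v hv => ?_, fun e he => ?_⟩
    · simp [hv]
    · have hsub : e ⊆ G.vertexSet := G.subset_vertexSet_of_mem_edgeSet he
      let s : Finset G.vertexSet := {v | v.1 ∈ e}
      have hs : Subtype.val '' (s : Set G.vertexSet) = e := by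
        ext v
        simpa [s] using fun h => hsub h
      have h := hg s (by simpa only [E, Set.mem_ofPred_eq, hs] using he)
      refine (min_le_left _ _).trans ?_
      rw [← hs, Set.image_image]
      have : (fun v : G.vertexSet => if h : v.1 ∈ G.vertexSet then (g ⟨v.1, h⟩ : ℕ) else 0) =
          Fin.val ∘ g := by
        funext v
        simp
      rw [this, Set.image_comp, Fin.val_injective.encard_image, ← Finset.coe_image,
        Set.encard_coe_eq_coe_finsetCard]
      exact_mod_cast (by omega : c ≤ (s.image g).card)

theorem mainTheorem2 (c t : ℕ) (hc : 2 ≤ c) (ht : 2 * c ≤ t) :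
    strongChromaticNumber t c < ((2 * c ^ 2 : ℕ) : ℕ∞) := by
  refine (iInf₂_le (2 * c ^ 2 - 1) fun α G hV hG => ?_).trans_lt
    (Nat.cast_lt.2 (Nat.sub_lt (by positivity) one_pos))
  exact Hypergraph.IsTIntersecting.strongColorable hc hV fun e he e' he' hne =>
    (Nat.cast_le.2 ht).trans (hG e he e' he' hne)
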